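/- Let $F$ be the cumulative distribution function of a continuous (atomless) probability distribution on $\mathbb{R}$ that is symmetric about $0$, and let $m$ teams have strengths $\mu=(\mu_1,\dots,\mu_m)$ satisfying a linear constraint $\sum_i c_i\mu_i=b$ with $\sum_i c_i\neq 0$. For $i<j$ put $p_{ij}=F(\mu_i-\mu_j)$, $q_{ij}=\max\{p_{ij},1-p_{ij}\}$, and let $Y_{ijk}\in\{0,1\}$ ($k\ge 1$) be independent with $P(Y_{ijk}=1)=p_{ij}$; $Y_{ijk}=1$ means that $i$ wins the $k$-th game of $i$ against $j$, and $Y_{ijk}=0$ that $j$ wins it. For counts $n=(n_{ij})_{i<j}$ let $N=\sum_{i<j}n_{ij}$ and $w_{ij}=\sum_{k\le n_{ij}}Y_{ijk}$. Consider only counts $n$ for which, with positive probability, the data satisfy the partition condition: for every partition of the teams into two nonempty sets, some team of the second set has defeated some team of the first. Let $\hat\mu=\hat\mu_n$ be an estimator which, whenever the data satisfy the partition condition, maximizes the likelihood $\prod_{i<j}F(\nu_i-\nu_j)^{w_{ij}}(1-F(\nu_i-\nu_j))^{n_{ij}-w_{ij}}$ over all $\nu$ with $\sum_i c_i\nu_i=b$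 (elsewhere $\hat\mu$ is arbitrary). ROC curves are parametrized by the threshold, $\theta\mapsto R(\theta)=(R_{FP}(\theta),R_{TP}(\theta))$, $\theta\in[0,1]$. For strengths $\nu$ put $p^\nu_{ij}=F(\nu_i-\nu_j)$ and $q^\nu_{ij}=\max\{p^\nu_{ij},1-p^\nu_{ij}\}$, and let $s^\nu_{ij}$ be the number of wins of the stronger team: $w_{ij}$ if $\nu_i>\nu_j$, $n_{ij}-w_{ij}$ if $\nu_i<\nu_j$, and $n_{ij}/2$ if $\nu_i=\nu_j$. The WL-ROC curve of $\nu$ is $$R_{FP}(\theta)=\frac1N\sum_{i<j}\Big((n_{ij}-w_{ij})\mathbb 1_{\{p^\nu_{ij}>\theta\}}+w_{ij}\mathbb 1_{\{1-p^\nu_{ij}>\theta\}}\Big),\qquad R_{TP}(\theta)=\frac1N\sum_{i<j}\Big(w_{ij}\mathbb 1_{\{p^\nu_{ij}>\theta\}}+(n_{ij}-w_{ij})\mathbb 1_{\{1-p^\nu_{ij}>\theta\}}\Big),$$ and the SW-ROC curve of $\nu$ is $$R_{FP}(\theta)=\frac{\sum_{i<j}(n_{ij}-s^\nu_{ij})\mathbb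 1_{\{q^\nu_{ij}>\theta\}}}{\sum_{i<j}(n_{ij}-s^\nu_{ij})},\qquad R_{TP}(\theta)=\frac{\sum_{i<j}s^\nu_{ij}\mathbb 1_{\{q^\nu_{ij}>\theta\}}}{\sum_{i<j}s^\nu_{ij}}$$ (a quotient with denominator $0$ is read as $0$). The estimated curves $\widehat f^{w\ell}_n,\widehat f^{sw}_n$ are those of $\nu=\hat\mu$ and the true curves $f^{w\ell}_n,f^{sw}_n$ those of $\nu=\mu$. The counts have design $\mathcal D=(d_{ij})_{i<j}$ if $d_{ij}=n_{ij}/N$ for all $i<j$. The limiting true WL-ROC curve $\widetilde f^{w\ell}_{\mathcal D}$ is obtained from the formula for the true WL-ROC curve by replacing $w_{ij}/N$ by $p_{ij}d_{ij}$ and $(n_{ij}-w_{ij})/N$ by $(1-p_{ij})d_{ij}$; the limiting true SW-ROC curve $\widetilde f^{sw}_{\mathcal D}$ is obtained from the formula for the true SW-ROC curve by replacing $s^\mu_{ij}$ by $q_{ij}d_{ij}$ and $n_{ij}-s^\mu_{ij}$ by $(1-q_{ij})d_{ij}$. Let $\rho$ be a metric on $\mathbb{R}^2$ that is continuous for the usual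 topology, let $1\le z<\infty$, and put $d_{\rho,z}(f,g)=\big(\int_0^1\rho(R^f(\theta),R^g(\theta))^z\,d\theta\big)^{1/z}$. Then for every $\epsilon>0$ there is $N^*$ such that for all such counts $n$ whose nonzero entries $n_{ij}$ all exceed $N^*$, $$P\big(d_{\rho,z}(\widehat f^{w\ell}_n,f^{w\ell}_n)\ge\epsilon\big)<\epsilon,\qquad P\big(d_{\rho,z}(\widehat f^{sw}_n,f^{sw}_n)\ge\epsilon\big)<\epsilon,$$ and, if $n$ has design $\mathcal D$, $$P\big(d_{\rho,z}(\widehat f^{w\ell}_n,\widetilde f^{w\ell}_{\mathcal D})\ge\epsilon\big)<\epsilon,\qquad P\big(d_{\rho,z}(\widehat f^{sw}_n,\widetilde f^{sw}_{\mathcal D})\ge\epsilon\big)<\epsilon.$$ -/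

import Mathlib

open MeasureTheory ProbabilityTheory

noncomputable section

namespace PairedComparison

/-- The unordered pairs of teams, each written as `(i, j)` with `i < j`. -/
abbrev Pair (m : ℕ) : Type := {e : Fin m × Fin m // e.1 < e.2}

variable {m : ℕ}

/-- The first team of a pair. -/
abbrev Pair.fst (e : Pair m) : Fin m := e.1.1

/-- The second team of a pair. -/
abbrev Pair.snd (e : Pair m) : Fin m := e.1.2

/-- The probability `p_ij = F (μ_i - μ_j)` that team `i` defeats team `j` in the linear paired
comparison model with link function `F` and strengths `μ`. -/
def winProb (F : ℝ → ℝ) (μ : Fin m → ℝ) (e : Pair m) : ℝ := F (μ e.fst - μ e.snd)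

/-- The total number `N` of comparisons, for pair counts `n`. -/
def totalGames (n : Pair m → ℕ) : ℕ := ∑ e, n e

/-- The number `w_ij` of wins of team `i` in the first `n_ij` games of `i` against `j` (`i < j`);
`y e k = true` says that the first team of the pair `e` wins the `k`-th game of that pair. -/
def wins (n : Pair m → ℕ) (y : Pair m → ℕ → Bool) (e : Pair m) : ℕ :=
  ((Finset.range (n e)).filter (fun k => y e k = true)).card

/-- Team `a` defeats team `b` in at least one of the games played. -/
def Defeats (n : Pair m → ℕ) (y : Pair m → ℕ → Bool) (a b : Fin m) : Prop :=
  (∃ e : Pair m, e.fst = a ∧ e.snd = b ∧ ∃ k < n e, y e k = true) ∨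
  (∃ e : Pair m, e.fst = b ∧ e.snd = a ∧ ∃ k < n e, y e k = false)

/-- The partition condition on the data: for every partition of the teams into two nonempty
sets, some team of the second set has defeated some team of the first set. -/
def PartitionCondition (n : Pair m → ℕ) (y : Pair m → ℕ → Bool) : Prop :=
  ∀ S : Set (Fin m), S.Nonempty → Sᶜ.Nonempty → ∃ b ∈ S, ∃ a ∈ Sᶜ, Defeats n y a b

/-- The likelihood of the strengths `ν` when pair `e` plays `n e` games and its first team wins
`w e` of them. -/
def likelihood (F : ℝ → ℝ) (n w : Pair m → ℕ) (ν : Fin m → ℝ) : ℝ :=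
  ∏ e, winProb F ν e ^ w e * (1 - winProb F ν e) ^ (n e - w e)

/-- The strengths that satisfy the linear constraint `∑ c_i ν_i = b`. -/
def constraintRegion (c : Fin m → ℝ) (b : ℝ) : Set (Fin m → ℝ) := {ν | ∑ i, c i * ν i = b}

/-- `ν` is a maximum likelihood estimate within the constraint region. -/
def IsMLE (F : ℝ → ℝ) (c : Fin m → ℝ) (b : ℝ) (n w : Pair m → ℕ) (ν : Fin m → ℝ) : Prop :=
  ν ∈ constraintRegion c b ∧ IsMaxOn (likelihood F n w) (constraintRegion c b) ν

/-- An ROC curve, parametrized by the threshold: `θ ↦ (FPR(θ), TPR(θ))`. -/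
abbrev ROCCurve : Type := ℝ → ℝ × ℝ

/-- The indicator of `x > θ`. -/
def above (θ x : ℝ) : ℝ := if θ < x then 1 else 0

/-- The winner-loser ROC curve in which the pair `e = (i, j)` has probability `p e` of a win of
`i`, and weight `a e` for the wins of `i` and `b e` for the wins of `j`; `T` is the total weight.
The `2R` terms of the sums are those of the values `p_ij` and `1 - p_ij`: at the value `p_ij` the
successes are the wins of `i` and the failures are its losses, that is, the wins of `j`. -/
def wlCurve (p a b : Pair m → ℝ) (T : ℝ) : ROCCurve := fun θ =>
  ((∑ e, (b e * above θ (p e) + a e * above θ (1 - p e))) / T,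
   (∑ e, (a e * above θ (p e) + b e * above θ (1 - p e))) / T)

/-- The strong-weak ROC curve in which the stronger team of the pair `e` wins with probability
`q e`, with weight `s e` for its wins and `t e` for its losses. -/
def swCurve (q s t : Pair m → ℝ) : ROCCurve := fun θ =>
  ((∑ e, t e * above θ (q e)) / ∑ e, t e, (∑ e, s e * above θ (q e)) / ∑ e, s e)

/-- The probability that the stronger team of a pair wins, for the strengths `ν`. -/
def strongProb (F : ℝ → ℝ) (ν : Fin m → ℝ) (e : Pair m) : ℝ :=
  max (winProb F ν e) (1 - winProb F ν e)

/-- The number of wins of the stronger team of a pair, where strength is measured by `ν`; in case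
of a tie, one of the two teams is the reference team and is given `n_ij / 2` wins. -/
def strongWins (ν : Fin m → ℝ) (n w : Pair m → ℕ) (e : Pair m) : ℝ :=
  if ν e.snd < ν e.fst then (w e : ℝ)
  else if ν e.fst < ν e.snd then (n e : ℝ) - (w e : ℝ)
  else (n e : ℝ) / 2

/-- The WL-ROC curve that the strengths `ν` give on the data `n`, `w`. It is the estimated curve
when `ν` is the maximum likelihood estimate and the true curve when `ν` is the true `μ`. -/
def dataWL (F : ℝ → ℝ) (ν : Fin m → ℝ) (n w : Pair m → ℕ) : ROCCurve :=
  wlCurve (winProb F ν) (fun e => (w e : ℝ)) (fun e => (n e : ℝ) - (w e : ℝ)) (totalGames n : ℝ)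

/-- The SW-ROC curve that the strengths `ν` give on the data `n`, `w`. It is the estimated curve
when `ν` is the maximum likelihood estimate and the true curve when `ν` is the true `μ`. -/
def dataSW (F : ℝ → ℝ) (ν : Fin m → ℝ) (n w : Pair m → ℕ) : ROCCurve :=
  swCurve (strongProb F ν) (strongWins ν n w) (fun e => (n e : ℝ) - strongWins ν n w e)

/-- The limiting true WL-ROC curve for the design ratios `D`. -/
def limitWL (F : ℝ → ℝ) (μ : Fin m → ℝ) (D : Pair m → ℝ) : ROCCurve :=
  wlCurve (winProb F μ) (fun e => winProb F μ e * D e) (fun e => (1 - winProb F μ e) * D e) 1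

/-- The limiting true SW-ROC curve for the design ratios `D`. -/
def limitSW (F : ℝ → ℝ) (μ : Fin m → ℝ) (D : Pair m → ℝ) : ROCCurve :=
  swCurve (strongProb F μ) (fun e => strongProb F μ e * D e)
    (fun e => (1 - strongProb F μ e) * D e)

/-- `ρ` is a metric on the plane that is continuous for the usual topology. -/
structure IsPlaneMetric (ρ : ℝ × ℝ → ℝ × ℝ → ℝ) : Prop where
  eq_zero_iff : ∀ x y, ρ x y = 0 ↔ x = y
  symm : ∀ x y, ρ x y = ρ y x
  triangle : ∀ x y t, ρ x t ≤ ρ x y + ρ y t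
  continuous : Continuous (fun x : (ℝ × ℝ) × (ℝ × ℝ) => ρ x.1 x.2)

/-- The ROC metric `d_{ρ,z}`. -/
def rocDist (ρ : ℝ × ℝ → ℝ × ℝ → ℝ) (z : ℝ) (f g : ROCCurve) : ℝ :=
  (∫ θ in (0 : ℝ)..1, ρ (f θ) (g θ) ^ z) ^ (1 / z)

end PairedComparison

end

namespace PairedComparison

/-! The curves depend on the strengths only through the win probabilities and the orderings of the
pairs that have played, so `muHat` itself need not converge. Let K be the number of pairs. By
Chebyshev and a union bound, outside an event of small probability every win count lies within √C
standard deviations of its mean. There a chi-square bound (`bernoulli_max_likelihood_le`) puts the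
likelihood of μ above exp(-K C) times the product of the pairwise maximal likelihoods. A Hellinger
bound (`bernoulli_likelihood_le`) puts that of any ν below the same product times exp(-n_e (p^ν_e -
w_e/n_e)² / 2), for each pair e. A maximizer is at least as likely as μ, so n_e (p^ν_e - w_e/n_e)² ≤
2 K C, and large counts force p^ν_e close to p_e on every played pair, whatever the design.

Deviations are kept in units of the variance n p (1 - p), which makes them small relative to the
expected wins and to the expected losses. Hence the good data inherit the partition condition
(`PartitionCondition.of_wins_close`), and the SW quotients are stable even if their denominators are
small.

Finally, a threshold away from all p_e and 1 - p_e gives the same indicators for the estimated and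
the true probabilities. The remaining thresholds have small total length, and ρ is bounded and
uniformly continuous on the unit square (`exists_rocDist_lt`). -/

/-! ### Bernoulli likelihoods compared with their maximum -/

/-- Square t ≤ exp (t - 1) at t = √x / √a and raise it to the power w. Taking the square root first
makes the exponents for successes and failures add up to a Hellinger distance, which stays finite at
x = 0. -/
theorem pow_le_pow_mul_exp_sqrt {x a r : ℝ} {w : ℕ} (hx : 0 ≤ x) (ha : 0 ≤ a)
    (hw : (w : ℝ) = r * a) (hr : 0 < r) :
    x ^ w ≤ a ^ w * Real.exp (2 * r * (√x * √a - a)) := by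
  rcases ha.eq_or_lt with rfl | ha
  · have : w = 0 := by simpa using hw
    simp [this]
  have hs : 0 < √a := Real.sqrt_pos.2 ha
  have h1 : √x / √a ≤ Real.exp (√x / √a - 1) := by
    have := Real.add_one_le_exp (√x / √a - 1); linarith
  have h2 : x ≤ a * Real.exp (2 * (√x / √a - 1)) := by
    have h3 : (√x / √a) ^ 2 ≤ Real.exp (√x / √a - 1) ^ 2 := pow_le_pow_left₀ (by positivity) h1 2
    rw [div_pow, Real.sq_sqrt hx, Real.sq_sqrt ha.le, ← Real.exp_nat_mul, div_le_iff₀ ha] at h3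
    push_cast at h3; linarith
  refine (pow_le_pow_left₀ hx h2 w).trans (le_of_eq ?_)
  rw [mul_pow, ← Real.exp_nat_mul, hw]
  congr 2
  have h4 : √a * √a = a := Real.mul_self_sqrt ha.le
  field_simp
  linear_combination -√x * h4

/-- The inequality t ≤ exp (t - 1) at t = a / p; the exponents for successes and failures add up to
a chi-square distance. -/
theorem pow_le_pow_mul_exp_div {a p r : ℝ} {w : ℕ} (ha : 0 ≤ a) (hp : 0 < p)
    (hw : (w : ℝ) = r * a) :
    a ^ w ≤ p ^ w * Real.exp (r * (a ^ 2 / p - a)) := by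
  have h2 : a ≤ p * Real.exp (a / p - 1) := by
    have := Real.add_one_le_exp (a / p - 1)
    rw [sub_add_cancel, div_le_iff₀ hp] at this
    linarith
  refine (pow_le_pow_left₀ ha h2 w).trans (le_of_eq ?_)
  rw [mul_pow, ← Real.exp_nat_mul, hw]
  congr 2
  field_simp

/-- The Bernoulli likelihood falls off from its maximum at least like a Gaussian. -/
theorem bernoulli_likelihood_le {x : ℝ} (hx0 : 0 ≤ x) (hx1 : x ≤ 1) {n w : ℕ} (hwn : w ≤ n) :
    x ^ w * (1 - x) ^ (n - w) ≤
      ((w / n : ℝ) ^ w * (1 - w / n) ^ (n - w)) * Real.exp (-(n * (x - w / n) ^ 2 / 2)) := by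
  rcases Nat.eq_zero_or_pos n with rfl | hn
  · obtain rfl : w = 0 := by omega
    simp
  have hn' : (0 : ℝ) < n := by exact_mod_cast hn
  have hwn' : (w : ℝ) ≤ n := by exact_mod_cast hwn
  set a : ℝ := w / n with ha
  have ha0 : 0 ≤ a := by positivity
  have ha1 : a ≤ 1 := (div_le_one hn').2 hwn'
  have hw : (w : ℝ) = n * a := by rw [ha]; field_simp
  have h1 := pow_le_pow_mul_exp_sqrt hx0 ha0 hw hn'
  have h2 := pow_le_pow_mul_exp_sqrt (x := 1 - x) (a := 1 - a) (r := n) (w := n - w)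
    (by linarith) (by linarith) (by rw [Nat.cast_sub hwn, hw]; ring) hn'
  refine (mul_le_mul h1 h2 (pow_nonneg (by linarith) _) (by positivity)).trans ?_
  rw [mul_mul_mul_comm, ← Real.exp_add]
  refine mul_le_mul_of_nonneg_left (Real.exp_le_exp.2 ?_)
    (mul_nonneg (by positivity) (pow_nonneg (by linarith) _))
  -- Since (u - v)² = (√u - √v)² (√u + √v)² and the last factor is at most 4, the squared Hellinger
  -- distance dominates the squared difference.
  have key : ∀ u v : ℝ, 0 ≤ u → u ≤ 1 → 0 ≤ v → v ≤ 1 →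
      2 * (√u * √v) ≤ u + v - (u - v) ^ 2 / 4 := by
    intro u v hu0 hu1 hv0 hv1
    have e1 := Real.mul_self_sqrt hu0
    have e2 := Real.mul_self_sqrt hv0
    have s1 := Real.sqrt_le_one.2 hu1
    have s2 := Real.sqrt_le_one.2 hv1
    have t1 := Real.sqrt_nonneg u
    have t2 := Real.sqrt_nonneg v
    have h : (u - v) ^ 2 = (√u - √v) ^ 2 * (√u + √v) ^ 2 := by
      rw [← mul_pow, show (√u - √v) * (√u + √v) = √u * √u - √v * √v by ring, e1, e2]
    have h4 : (√u + √v) ^ 2 ≤ 4 := by nlinarith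
    nlinarith [mul_le_mul_of_nonneg_left h4 (sq_nonneg (√u - √v))]
  have k1 := key x a hx0 hx1 ha0 ha1
  have k2 := key (1 - x) (1 - a) (by linarith) (by linarith) (by linarith) (by linarith)
  have : 2 * (√x * √a - a) + 2 * (√(1 - x) * √(1 - a) - (1 - a)) ≤ -((x - a) ^ 2 / 2) := by
    nlinarith
  nlinarith [mul_le_mul_of_nonneg_left this hn'.le]

/-- The Bernoulli likelihood at `p` is at least a constant fraction of its maximum when the
number of successes is within a fixed number of standard deviations of its mean. -/
theorem bernoulli_max_likelihood_le {p C : ℝ} (hp0 : 0 ≤ p) (hp1 : p ≤ 1) (hC : 0 ≤ C) {n w : ℕ}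
    (hwn : w ≤ n) (h : ((w : ℝ) - n * p) ^ 2 ≤ C * (n * (p * (1 - p)))) :
    (w / n : ℝ) ^ w * (1 - w / n) ^ (n - w) ≤ (p ^ w * (1 - p) ^ (n - w)) * Real.exp C := by
  rcases Nat.eq_zero_or_pos n with rfl | hn
  · obtain rfl : w = 0 := by omega
    simpa using hC
  have hn' : (0 : ℝ) < n := by exact_mod_cast hn
  have hwn' : (w : ℝ) ≤ n := by exact_mod_cast hwn
  set a : ℝ := w / n with ha
  have ha0 : 0 ≤ a := by positivity
  have ha1 : a ≤ 1 := (div_le_one hn').2 hwn'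
  have hw : (w : ℝ) = n * a := by rw [ha]; field_simp
  -- Without variance the hypothesis forces w = n p, so p already attains the maximum.
  by_cases hv : p * (1 - p) = 0
  · have hap : a = p := by
      rw [hv, mul_zero, mul_zero] at h
      have : (w : ℝ) - n * p = 0 := by nlinarith
      rw [ha, div_eq_iff hn'.ne']; linarith
    rw [hap]
    exact le_mul_of_one_le_right (mul_nonneg (by positivity) (pow_nonneg (by linarith) _))
      (Real.one_le_exp hC)
  have hp0' : 0 < p := lt_of_le_of_ne hp0 (by rintro rfl; simp at hv)
  have hp1' : 0 < 1 - p := lt_of_le_of_ne (by linarith) (by intro h; simp [← h] at hv)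
  have h1 := pow_le_pow_mul_exp_div ha0 hp0' hw
  have h2 := pow_le_pow_mul_exp_div (a := 1 - a) (p := 1 - p) (r := n) (w := n - w)
    (by linarith) hp1' (by rw [Nat.cast_sub hwn, hw]; ring)
  refine (mul_le_mul h1 h2 (pow_nonneg (by linarith) _) (by positivity)).trans ?_
  rw [mul_mul_mul_comm, ← Real.exp_add]
  refine mul_le_mul_of_nonneg_left (Real.exp_le_exp.2 ?_) (by positivity)
  have e : (n : ℝ) * (a ^ 2 / p - a) + n * ((1 - a) ^ 2 / (1 - p) - (1 - a))
      = (n * (a - p) ^ 2) / (p * (1 - p)) := by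
    field_simp; ring
  rw [e, div_le_iff₀ (by positivity)]
  rw [hw] at h
  have : (n : ℝ) * (n * (a - p) ^ 2) ≤ n * (C * (p * (1 - p))) := by nlinarith
  exact le_of_mul_le_mul_left this hn'

/-! ### Fit of the played pairs under maximum likelihood -/

variable {m : ℕ}

/-- A strength vector of at least the likelihood of `μ` fits every pair well. -/
theorem sq_sub_le_of_likelihood_le {F : ℝ → ℝ} (hF0 : ∀ x, 0 ≤ F x) (hF1 : ∀ x, F x ≤ 1)
    {n w : Pair m → ℕ} (hwn : ∀ e, w e ≤ n e) {μ ν : Fin m → ℝ} {C : ℝ} (hC : 0 ≤ C)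
    (hw : ∀ e, ((w e : ℝ) - n e * winProb F μ e) ^ 2 ≤
      C * (n e * (winProb F μ e * (1 - winProb F μ e))))
    (hL : likelihood F n w μ ≤ likelihood F n w ν) (e : Pair m) :
    n e * (winProb F ν e - w e / n e) ^ 2 ≤ 2 * (Fintype.card (Pair m) * C) := by
  -- The maximal likelihood of each pair, attained at the observed frequency. It is positive even at
  -- frequencies 0 and 1, because 0 ^ 0 = 1, and so it can be cancelled at the end.
  set M : Pair m → ℝ := fun e => (w e / n e : ℝ) ^ w e * (1 - w e / n e) ^ (n e - w e) with hM
  have hMpos : ∀ e, 0 < M e := by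
    intro e
    have hwn' : (w e : ℝ) ≤ n e := by exact_mod_cast hwn e
    refine mul_pos ?_ ?_
    · rcases Nat.eq_zero_or_pos (w e) with h | h
      · simp [h]
      · have : 0 < n e := h.trans_le (hwn e)
        positivity
    · rcases (hwn e).eq_or_lt with h | h
      · simp [h]
      · have : (0 : ℝ) < n e := by exact_mod_cast (Nat.zero_le _).trans_lt h
        have h' : (w e : ℝ) < n e := by exact_mod_cast h
        exact pow_pos (sub_pos.2 ((div_lt_one this).2 h')) _
  have h1 : ∏ e, M e ≤ likelihood F n w μ * Real.exp (Fintype.card (Pair m) * C) := by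
    have := Finset.prod_le_prod (s := Finset.univ) (fun e _ => (hMpos e).le)
      (fun e _ => bernoulli_max_likelihood_le (hF0 _) (hF1 _) hC (hwn e) (hw e))
    refine this.trans (le_of_eq ?_)
    rw [Finset.prod_mul_distrib (g := fun _ => Real.exp C), Finset.prod_const, Finset.card_univ,
      ← Real.exp_nat_mul]
    rfl
  have h2 : likelihood F n w ν ≤
      (∏ e, M e) * Real.exp (-(n e * (winProb F ν e - w e / n e) ^ 2 / 2)) := by
    have := Finset.prod_le_prod (s := Finset.univ)
      (fun e _ => mul_nonneg (pow_nonneg (hF0 _) _) (pow_nonneg (sub_nonneg.2 (hF1 _)) _))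
      (fun e _ => bernoulli_likelihood_le (hF0 (ν e.fst - ν e.snd)) (hF1 _) (hwn e))
    rw [Finset.prod_mul_distrib (g := fun e => Real.exp _), ← Real.exp_sum] at this
    refine this.trans (mul_le_mul_of_nonneg_left (Real.exp_le_exp.2 ?_)
      (Finset.prod_nonneg fun e _ => (hMpos e).le))
    rw [Finset.sum_neg_distrib, neg_le_neg_iff]
    exact Finset.single_le_sum (f := fun e => (n e : ℝ) * (winProb F ν e - w e / n e) ^ 2 / 2)
      (fun e _ => by positivity) (Finset.mem_univ e)
  have hP : 0 < ∏ e, M e := Finset.prod_pos fun e _ => hMpos e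
  have h3 := h1.trans (mul_le_mul_of_nonneg_right (hL.trans h2) (Real.exp_nonneg _))
  rw [mul_assoc, ← Real.exp_add] at h3
  have h4 := le_of_mul_le_mul_left ((mul_one _).le.trans h3) hP
  have h5 := Real.one_le_exp_iff.1 h4
  linarith

/-- Large counts turn closeness in standard deviations into closeness of frequencies. -/
theorem exists_count_bound {p C K δ : ℝ} (hp0 : 0 ≤ p) (hp1 : p ≤ 1) (hδ : 0 < δ) :
    ∃ N : ℕ, ∀ n : ℕ, N < n → ∀ w : ℝ, (w - n * p) ^ 2 ≤ C * (n * (p * (1 - p))) →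
      |w - n * p| ≤ δ * (n * (p * (1 - p))) ∧
      ∀ x, n * (x - w / n) ^ 2 ≤ K →
        |x - p| ≤ δ ∧ (1 / 2 < p → 1 / 2 < x) ∧ (p < 1 / 2 → x < 1 / 2) := by
  -- The radius γ stays below the distance from p to 1/2, so that closeness also preserves the side
  -- of 1/2.
  obtain ⟨γ, hγ, hγδ, hγp⟩ : ∃ γ > 0, γ ≤ δ ∧ (p ≠ 1 / 2 → γ < |p - 1 / 2|) := by
    by_cases h : p = 1 / 2
    · exact ⟨δ, hδ, le_rfl, fun h' => absurd h h'⟩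
    · have : 0 < |p - 1 / 2| := abs_pos.2 (sub_ne_zero.2 h)
      exact ⟨min δ (|p - 1 / 2| / 2), by positivity, min_le_left _ _,
        fun _ => (min_le_right _ _).trans_lt (by linarith)⟩
  have hv0 : 0 ≤ p * (1 - p) := mul_nonneg hp0 (by linarith)
  have hv1 : p * (1 - p) ≤ 1 := by nlinarith
  -- The first bound turns √C standard deviations into a small multiple of the variance; if the
  -- variance is 0, the quotient is 0 and the deviation vanishes anyway. The second makes K / n at
  -- most (γ / 2)².
  obtain ⟨N, hN⟩ := exists_nat_gt (max (C / (min δ (γ / 2) ^ 2 * (p * (1 - p)))) (K / (γ / 2) ^ 2))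
  refine ⟨N, fun n hn w hw => ?_⟩
  have hn' : (N : ℝ) < n := by exact_mod_cast hn
  have hn0 : (0 : ℝ) < n := (Nat.cast_nonneg N).trans_lt hn'
  have hη : 0 < min δ (γ / 2) := by positivity
  have h1 : |w - n * p| ≤ min δ (γ / 2) * (n * (p * (1 - p))) := by
    refine abs_le_of_sq_le_sq ?_ (by positivity)
    refine hw.trans ?_
    rcases hv0.eq_or_lt with hv | hv
    · simp [← hv]
    · have := ((le_max_left _ _).trans_lt hN).trans hn'
      rw [div_lt_iff₀ (by positivity)] at this
      have h3 := mul_le_mul_of_nonneg_right this.le (show 0 ≤ n * (p * (1 - p)) by positivity)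
      linarith
  refine ⟨h1.trans (mul_le_mul_of_nonneg_right (min_le_left _ _) (by positivity)),
    fun x hx => ?_⟩
  have h2 : |w / n - p| ≤ γ / 2 := by
    rw [show w / n - p = (w - n * p) / n by field_simp, abs_div, abs_of_pos hn0,
      div_le_iff₀ hn0]
    refine h1.trans ?_
    refine mul_le_mul (min_le_right _ _) ?_ (by positivity) (by positivity)
    nlinarith
  have h3 : |x - w / n| ≤ γ / 2 := by
    refine abs_le_of_sq_le_sq ?_ (by positivity)
    have := ((le_max_right _ _).trans_lt hN).trans hn'
    rw [div_lt_iff₀ (by positivity)] at this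
    exact le_of_mul_le_mul_left (hx.trans this.le) hn0
  have h4 : |x - p| ≤ γ := by
    have := abs_sub_le x (w / n) p
    linarith
  rw [abs_le] at h4
  refine ⟨(abs_le.2 h4).trans hγδ, fun h => ?_, fun h => ?_⟩
  · have := hγp h.ne'
    rw [abs_of_pos (by linarith)] at this
    linarith
  · have := hγp h.ne
    rw [abs_of_neg (by linarith)] at this
    linarith

/-! ### Threshold indicators and the ROC metric -/

theorem above_nonneg (θ x : ℝ) : 0 ≤ above θ x := by unfold above; split_ifs <;> norm_num

theorem above_le_one (θ x : ℝ) : above θ x ≤ 1 := by unfold above; split_ifs <;> norm_num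

theorem above_congr {θ x y δ : ℝ} (hxy : |x - y| ≤ δ) (hθ : θ ∉ Metric.closedBall y δ) :
    above θ x = above θ y := by
  rw [Metric.mem_closedBall, Real.dist_eq, not_le, lt_abs] at hθ
  rw [abs_le] at hxy
  unfold above
  rcases hθ with h | h
  · rw [if_neg (by linarith), if_neg (by linarith)]
  · rw [if_pos (by linarith), if_pos (by linarith)]

theorem IsPlaneMetric.nonneg {ρ : ℝ × ℝ → ℝ × ℝ → ℝ} (hρ : IsPlaneMetric ρ) (x y : ℝ × ℝ) :
    0 ≤ ρ x y := by
  have h1 := hρ.triangle x y x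
  rw [(hρ.eq_zero_iff x x).2 rfl, hρ.symm y x] at h1
  linarith

/-- Curves in the unit square that are uniformly close off a small set of thresholds are close in
the ROC metric. -/
theorem exists_rocDist_lt {ρ : ℝ × ℝ → ℝ × ℝ → ℝ} (hρ : IsPlaneMetric ρ) {z : ℝ} (hz : 1 ≤ z)
    {ε : ℝ} (hε : 0 < ε) :
    ∃ η > 0, ∀ (f g : ROCCurve) (B : Set ℝ), (∀ θ, f θ ∈ Set.Icc 0 1) →
      (∀ θ, g θ ∈ Set.Icc 0 1) → MeasurableSet B → volume B ≤ ENNReal.ofReal η →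
      (∀ θ ∉ B, dist (f θ) (g θ) ≤ η) → rocDist ρ z f g < ε := by
  have hz0 : 0 < z := by linarith
  have hK : IsCompact (Set.Icc (0 : ℝ × ℝ) 1 ×ˢ Set.Icc (0 : ℝ × ℝ) 1) :=
    isCompact_Icc.prod isCompact_Icc
  have huc := hK.uniformContinuousOn_of_continuous hρ.continuous.continuousOn
  obtain ⟨M, hM⟩ := hK.exists_bound_of_continuousOn hρ.continuous.continuousOn
  have hM0 : 0 ≤ M := (norm_nonneg _).trans (hM (0, 0) (by simp))
  obtain ⟨η₁, hη₁, hu⟩ := Metric.uniformContinuousOn_iff.1 huc (ε / 2) (by positivity)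
  have hgap : (ε / 2) ^ z < ε ^ z := Real.rpow_lt_rpow (by positivity) (by linarith) hz0
  set G : ℝ := ε ^ z - (ε / 2) ^ z with hG
  have hG0 : 0 < G := sub_pos.2 hgap
  have hMz : 0 ≤ M ^ z := Real.rpow_nonneg hM0 z
  -- The first entry keeps ρ below ε / 2 off B. The second keeps the contribution of B, at most η M
  -- ^ z, below the gap G between ε ^ z and (ε / 2) ^ z.
  refine ⟨min (η₁ / 2) (G / (2 * (M ^ z + 1))), by positivity, ?_⟩
  intro f g B hf hg hB hvol hfg
  set η := min (η₁ / 2) (G / (2 * (M ^ z + 1))) with hη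
  have hη0 : 0 < η := by positivity
  have hint : ∫ θ in (0 : ℝ)..1, ρ (f θ) (g θ) ^ z ≤ (ε / 2) ^ z + η * M ^ z := by
    rw [intervalIntegral.integral_of_le zero_le_one]
    have hgi : Integrable (fun θ => (ε / 2) ^ z + B.indicator (fun _ => M ^ z) θ)
        (volume.restrict (Set.Ioc (0 : ℝ) 1)) :=
      (integrable_const _).add ((integrable_const _).indicator hB)
    -- Only the majorant has to be integrable, so no measurability of the curves is needed.
    refine (integral_mono_of_nonneg (.of_forall fun θ => Real.rpow_nonneg (hρ.nonneg _ _) z) hgi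
      (.of_forall fun θ => ?_)).trans ?_
    · by_cases hθ : θ ∈ B
      · simp only [Set.indicator_of_mem hθ]
        have h1 : ρ (f θ) (g θ) ≤ M := (le_abs_self _).trans (hM (f θ, g θ) ⟨hf θ, hg θ⟩)
        have h2 := Real.rpow_le_rpow (hρ.nonneg _ _) h1 hz0.le
        have h3 : 0 ≤ (ε / 2) ^ z := by positivity
        linarith
      · simp only [Set.indicator_of_notMem hθ, add_zero]
        have h1 := hu (f θ, g θ) ⟨hf θ, hg θ⟩ (g θ, g θ) ⟨hg θ, hg θ⟩ (by
          rw [Prod.dist_eq]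
          simp only [dist_self]
          rw [max_eq_left dist_nonneg]
          have := (hfg θ hθ).trans (min_le_left _ _)
          linarith)
        simp only [Real.dist_eq, (hρ.eq_zero_iff _ _).2 rfl, sub_zero] at h1
        exact Real.rpow_le_rpow (hρ.nonneg _ _) ((le_abs_self _).trans h1.le) hz0.le
    · rw [integral_add (integrable_const _) ((integrable_const _).indicator hB),
        integral_indicator_const _ hB]
      simp only [integral_const, smul_eq_mul, Measure.real]
      have h1 : ((volume.restrict (Set.Ioc (0 : ℝ) 1)) B).toReal ≤ η :=
        ENNReal.toReal_le_of_le_ofReal hη0.le ((Measure.restrict_apply_le _ _).trans hvol)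
      have h2 := mul_le_mul_of_nonneg_right h1 hMz
      simpa using h2
  have hlt : (ε / 2) ^ z + η * M ^ z < ε ^ z := by
    have h1 : η * (M ^ z + 1) ≤ G / 2 := by
      have := mul_le_mul_of_nonneg_right (min_le_right (η₁ / 2) (G / (2 * (M ^ z + 1))))
        (show 0 ≤ M ^ z + 1 by positivity)
      rw [← hη] at this
      refine this.trans (le_of_eq ?_)
      field_simp
    nlinarith
  have hnn : 0 ≤ ∫ θ in (0 : ℝ)..1, ρ (f θ) (g θ) ^ z :=
    intervalIntegral.integral_nonneg zero_le_one fun θ _ => Real.rpow_nonneg (hρ.nonneg _ _) z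
  have := Real.rpow_lt_rpow hnn (hint.trans_lt hlt) (show 0 < 1 / z by positivity)
  rwa [← Real.rpow_mul hε.le, mul_one_div_cancel hz0.ne', Real.rpow_one] at this

/-! ### Weighted averages and curves in the unit square -/

theorem sum_mul_div_sum_mem_Icc {ι : Type*} [Fintype ι] {t χ : ι → ℝ} (ht : ∀ e, 0 ≤ t e)
    (hχ0 : ∀ e, 0 ≤ χ e) (hχ1 : ∀ e, χ e ≤ 1) :
    (∑ e, t e * χ e) / ∑ e, t e ∈ Set.Icc (0 : ℝ) 1 := by
  refine ⟨div_nonneg (Finset.sum_nonneg fun e _ => mul_nonneg (ht e) (hχ0 e))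
    (Finset.sum_nonneg fun e _ => ht e), div_le_one_of_le₀ (Finset.sum_le_sum fun e _ => ?_)
    (Finset.sum_nonneg fun e _ => ht e)⟩
  exact mul_le_of_le_one_right (ht e) (hχ1 e)

/-- A weighted average changes little when every weight has a small relative error. -/
theorem abs_sum_mul_div_sum_sub_le {ι : Type*} [Fintype ι] {t u χ : ι → ℝ} {δ : ℝ} (hδ : δ < 1)
    (ht : ∀ e, 0 ≤ t e) (hu : ∀ e, 0 ≤ u e) (htu : ∀ e, |t e - u e| ≤ δ * u e)
    (hχ0 : ∀ e, 0 ≤ χ e) (hχ1 : ∀ e, χ e ≤ 1) (hδ0 : 0 ≤ δ) :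
    |(∑ e, t e * χ e) / ∑ e, t e - (∑ e, u e * χ e) / ∑ e, u e| ≤ 2 * δ := by
  have hmem := sum_mul_div_sum_mem_Icc ht hχ0 hχ1
  set T := ∑ e, t e with hT
  set U := ∑ e, u e with hU
  set A := ∑ e, t e * χ e with hA
  set V := ∑ e, u e * χ e with hV
  have hU0 : 0 ≤ U := Finset.sum_nonneg fun e _ => hu e
  have hTU : |T - U| ≤ δ * U := by
    rw [hT, hU, ← Finset.sum_sub_distrib, Finset.mul_sum]
    exact (Finset.abs_sum_le_sum_abs _ _).trans (Finset.sum_le_sum fun e _ => htu e)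
  have hAV : |A - V| ≤ δ * U := by
    rw [hA, hV, hU, ← Finset.sum_sub_distrib, Finset.mul_sum]
    refine (Finset.abs_sum_le_sum_abs _ _).trans (Finset.sum_le_sum fun e _ => ?_)
    rw [← sub_mul, abs_mul, abs_of_nonneg (hχ0 e)]
    exact (mul_le_of_le_one_right (abs_nonneg _) (hχ1 e)).trans (htu e)
  rcases hU0.eq_or_lt with h | hU0
  · rw [← h, mul_zero] at hTU
    have : T = 0 := by
      have := abs_nonpos_iff.1 hTU
      linarith
    rw [this, ← h]; simpa using hδ0
  have hT0 : 0 < T := by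
    have := (abs_le.1 hTU).1
    nlinarith
  -- Since A / T lies in [0, 1], both numerator terms are at most δ U in absolute value, and no
  -- lower bound on U is required.
  have e : A / T - V / U = (A / T * (U - T) + (A - V)) / U := by
    field_simp; ring
  rw [e, abs_div, abs_of_pos hU0, div_le_iff₀ hU0]
  refine (abs_add_le _ _).trans ?_
  rw [abs_mul, abs_of_nonneg hmem.1, abs_sub_comm U T]
  have := mul_le_of_le_one_left (abs_nonneg (T - U)) hmem.2
  linarith

theorem wlCurve_mem_Icc {p a b : Pair m → ℝ} {T : ℝ} (ha : ∀ e, 0 ≤ a e) (hb : ∀ e, 0 ≤ b e)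
    (hT : ∑ e, (a e + b e) ≤ T) (θ : ℝ) : wlCurve p a b T θ ∈ Set.Icc 0 1 := by
  have hT0 : 0 ≤ T := (Finset.sum_nonneg fun e _ => add_nonneg (ha e) (hb e)).trans hT
  have key : ∀ a b : Pair m → ℝ, (∀ e, 0 ≤ a e) → (∀ e, 0 ≤ b e) → ∑ e, (a e + b e) ≤ T →
      (∑ e, (a e * above θ (p e) + b e * above θ (1 - p e))) / T ∈ Set.Icc (0 : ℝ) 1 := by
    intro a b ha hb hT
    refine ⟨div_nonneg (Finset.sum_nonneg fun e _ => add_nonneg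
      (mul_nonneg (ha e) (above_nonneg _ _)) (mul_nonneg (hb e) (above_nonneg _ _))) hT0,
      div_le_one_of_le₀ ((Finset.sum_le_sum fun e _ => ?_).trans hT) hT0⟩
    exact add_le_add (mul_le_of_le_one_right (ha e) (above_le_one _ _))
      (mul_le_of_le_one_right (hb e) (above_le_one _ _))
  have h1 := key b a hb ha (by simpa only [add_comm] using hT)
  have h2 := key a b ha hb hT
  exact ⟨⟨h1.1, h2.1⟩, ⟨h1.2, h2.2⟩⟩

theorem swCurve_mem_Icc {q s t : Pair m → ℝ} (hs : ∀ e, 0 ≤ s e) (ht : ∀ e, 0 ≤ t e) (θ : ℝ) :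
    swCurve q s t θ ∈ Set.Icc 0 1 := by
  have h1 := sum_mul_div_sum_mem_Icc ht (fun e => above_nonneg θ (q e))
    (fun e => above_le_one θ (q e))
  have h2 := sum_mul_div_sum_mem_Icc hs (fun e => above_nonneg θ (q e))
    (fun e => above_le_one θ (q e))
  exact ⟨⟨h1.1, h2.1⟩, ⟨h1.2, h2.2⟩⟩

theorem strongWins_mem_Icc (ν : Fin m → ℝ) {n w : Pair m → ℕ} (hwn : ∀ e, w e ≤ n e)
    (e : Pair m) : strongWins ν n w e ∈ Set.Icc (0 : ℝ) (n e) := by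
  have h : (w e : ℝ) ≤ n e := by exact_mod_cast hwn e
  have h0 : (0 : ℝ) ≤ w e := Nat.cast_nonneg _
  have h1 : (0 : ℝ) ≤ n e := Nat.cast_nonneg _
  unfold strongWins
  split_ifs <;> constructor <;> linarith

theorem dataWL_mem_Icc (F : ℝ → ℝ) (ν : Fin m → ℝ) {n w : Pair m → ℕ} (hwn : ∀ e, w e ≤ n e)
    (θ : ℝ) : dataWL F ν n w θ ∈ Set.Icc 0 1 := by
  refine wlCurve_mem_Icc (fun e => Nat.cast_nonneg _)
    (fun e => sub_nonneg.2 (by exact_mod_cast hwn e)) ?_ θ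
  simp [totalGames]

theorem dataSW_mem_Icc (F : ℝ → ℝ) (ν : Fin m → ℝ) {n w : Pair m → ℕ} (hwn : ∀ e, w e ≤ n e)
    (θ : ℝ) : dataSW F ν n w θ ∈ Set.Icc 0 1 :=
  swCurve_mem_Icc (fun e => (strongWins_mem_Icc ν hwn e).1)
    (fun e => sub_nonneg.2 (strongWins_mem_Icc ν hwn e).2) θ

theorem strongProb_le_one {F : ℝ → ℝ} (hF0 : ∀ x, 0 ≤ F x) (hF1 : ∀ x, F x ≤ 1) (ν : Fin m → ℝ)
    (e : Pair m) : strongProb F ν e ≤ 1 :=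
  max_le (hF1 _) (by have : 0 ≤ winProb F ν e := hF0 _
                     linarith)

theorem strongProb_nonneg {F : ℝ → ℝ} (hF0 : ∀ x, 0 ≤ F x) (ν : Fin m → ℝ)
    (e : Pair m) : 0 ≤ strongProb F ν e := le_max_of_le_left (hF0 _)

/-- The design ratios of given counts. -/
noncomputable def design (n : Pair m → ℕ) (e : Pair m) : ℝ := (n e : ℝ) / (totalGames n : ℝ)

theorem design_nonneg (n : Pair m → ℕ) (e : Pair m) : 0 ≤ design n e := by
  unfold design; positivity

theorem sum_design_le_one (n : Pair m → ℕ) : ∑ e, design n e ≤ 1 := by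
  unfold design
  rw [← Finset.sum_div]
  have : ∑ e, (n e : ℝ) = totalGames n := by simp [totalGames]
  rw [this]
  exact div_self_le_one _

theorem limitWL_mem_Icc {F : ℝ → ℝ} (hF0 : ∀ x, 0 ≤ F x) (hF1 : ∀ x, F x ≤ 1) (μ : Fin m → ℝ)
    (n : Pair m → ℕ) (θ : ℝ) : limitWL F μ (design n) θ ∈ Set.Icc 0 1 := by
  refine wlCurve_mem_Icc (fun e => mul_nonneg (hF0 _) (design_nonneg n e))
    (fun e => mul_nonneg (sub_nonneg.2 (hF1 _)) (design_nonneg n e)) ?_ θ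
  refine le_trans (le_of_eq (Finset.sum_congr rfl fun e _ => ?_)) (sum_design_le_one n)
  ring

theorem limitSW_mem_Icc {F : ℝ → ℝ} (hF0 : ∀ x, 0 ≤ F x) (hF1 : ∀ x, F x ≤ 1) (μ : Fin m → ℝ)
    (n : Pair m → ℕ) (θ : ℝ) : limitSW F μ (design n) θ ∈ Set.Icc 0 1 :=
  swCurve_mem_Icc (fun e => mul_nonneg (strongProb_nonneg hF0 μ e) (design_nonneg n e))
    (fun e => mul_nonneg (sub_nonneg.2 (strongProb_le_one hF0 hF1 μ e)) (design_nonneg n e)) θ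

/-! ### Closeness of the curves away from the jumps -/

/-- The thresholds within `δ` of a jump of the true curves. -/
def jumpSet (F : ℝ → ℝ) (μ : Fin m → ℝ) (δ : ℝ) : Set ℝ :=
  ⋃ e : Pair m, Metric.closedBall (winProb F μ e) δ ∪ Metric.closedBall (1 - winProb F μ e) δ

theorem measurableSet_jumpSet (F : ℝ → ℝ) (μ : Fin m → ℝ) (δ : ℝ) :
    MeasurableSet (jumpSet F μ δ) :=
  MeasurableSet.iUnion fun _ =>
    Metric.isClosed_closedBall.measurableSet.union Metric.isClosed_closedBall.measurableSet

theorem volume_jumpSet_le (F : ℝ → ℝ) (μ : Fin m → ℝ) {δ : ℝ} (hδ : 0 ≤ δ) :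
    volume (jumpSet F μ δ) ≤ ENNReal.ofReal (Fintype.card (Pair m) * (4 * δ)) := by
  unfold jumpSet
  refine (measure_iUnion_fintype_le _ _).trans ?_
  refine (Finset.sum_le_card_nsmul _ _ (ENNReal.ofReal (4 * δ)) fun e _ => ?_).trans ?_
  · refine (measure_union_le _ _).trans ?_
    rw [Real.volume_closedBall, Real.volume_closedBall, ← ENNReal.ofReal_add (by positivity)
      (by positivity)]
    exact ENNReal.ofReal_le_ofReal (by linarith)
  · rw [nsmul_eq_mul, ENNReal.ofReal_mul (Nat.cast_nonneg _), ENNReal.ofReal_natCast,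
      Finset.card_univ]

theorem abs_strongProb_sub_le {F : ℝ → ℝ} {ν μ : Fin m → ℝ} {e : Pair m} {δ : ℝ}
    (h : |winProb F ν e - winProb F μ e| ≤ δ) : |strongProb F ν e - strongProb F μ e| ≤ δ := by
  unfold strongProb
  refine (abs_max_sub_max_le_max _ _ _ _).trans (max_le h ?_)
  rwa [sub_sub_sub_cancel_left, abs_sub_comm]

/-- Off the jump set the indicators agree on played pairs, and unplayed pairs have weight 0. Only
the weights differ, by at most δ times the design ratio for each of the two terms of a pair, and the
ratios sum to at most 1. -/
theorem dist_dataWL_limitWL_le {F : ℝ → ℝ} (hF0 : ∀ x, 0 ≤ F x) (hF1 : ∀ x, F x ≤ 1)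
    {μ ν : Fin m → ℝ} {n w : Pair m → ℕ} (hwn : ∀ e, w e ≤ n e) {δ : ℝ} (hδ : 0 ≤ δ)
    (hw : ∀ e, |(w e : ℝ) - n e * winProb F μ e| ≤
      δ * (n e * (winProb F μ e * (1 - winProb F μ e))))
    (hν : ∀ e, n e ≠ 0 → |winProb F ν e - winProb F μ e| ≤ δ) {θ : ℝ} (hθ : θ ∉ jumpSet F μ δ) :
    dist (dataWL F ν n w θ) (limitWL F μ (design n) θ) ≤ 2 * δ := by
  simp only [jumpSet, Set.mem_iUnion, Set.mem_union, not_exists, not_or] at hθ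
  have hχ1 : ∀ e, n e ≠ 0 → above θ (winProb F ν e) = above θ (winProb F μ e) :=
    fun e he => above_congr (hν e he) (hθ e).1
  have hχ2 : ∀ e, n e ≠ 0 → above θ (1 - winProb F ν e) = above θ (1 - winProb F μ e) :=
    fun e he => above_congr
      (by rw [sub_sub_sub_cancel_left, abs_sub_comm]; exact hν e he) (hθ e).2
  have hN : (0 : ℝ) ≤ totalGames n := Nat.cast_nonneg _
  have hwD : ∀ e, |(w e : ℝ) / totalGames n - winProb F μ e * design n e| ≤ δ * design n e := by
    intro e
    have : (w e : ℝ) / totalGames n - winProb F μ e * design n e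
        = (w e - n e * winProb F μ e) / totalGames n := by
      unfold design; ring
    rw [this, abs_div, abs_of_nonneg hN, design, ← mul_div_assoc]
    refine div_le_div_of_nonneg_right ((hw e).trans ?_) hN
    have h0 : 0 ≤ winProb F μ e := hF0 _
    have h1 : winProb F μ e ≤ 1 := hF1 _
    refine mul_le_mul_of_nonneg_left (mul_le_of_le_one_right (Nat.cast_nonneg _) ?_) hδ
    nlinarith
  have hlD : ∀ e, |((n e : ℝ) - w e) / totalGames n - (1 - winProb F μ e) * design n e|
      ≤ δ * design n e := by
    intro e
    have : ((n e : ℝ) - w e) / totalGames n - (1 - winProb F μ e) * design n e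
        = -((w e : ℝ) / totalGames n - winProb F μ e * design n e) := by
      unfold design; ring
    rw [this, abs_neg]
    exact hwD e
  have key : ∀ a a' b b' : Pair m → ℝ, (∀ e, n e = 0 → a e = 0) → (∀ e, n e = 0 → b e = 0) →
      (∀ e, |a e / totalGames n - a' e| ≤ δ * design n e) →
      (∀ e, |b e / totalGames n - b' e| ≤ δ * design n e) →
      |(∑ e, (a e * above θ (winProb F ν e) + b e * above θ (1 - winProb F ν e))) / totalGames n -
        (∑ e, (a' e * above θ (winProb F μ e) + b' e * above θ (1 - winProb F μ e))) / 1|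
        ≤ 2 * δ := by
    intro a a' b b' ha0 hb0 ha hb
    have e1 : ∀ e, a e * above θ (winProb F ν e) + b e * above θ (1 - winProb F ν e)
        = a e * above θ (winProb F μ e) + b e * above θ (1 - winProb F μ e) := by
      intro e
      by_cases he : n e = 0
      · rw [ha0 e he, hb0 e he]; simp
      · rw [hχ1 e he, hχ2 e he]
    simp only [e1]
    rw [div_one, Finset.sum_div, ← Finset.sum_sub_distrib]
    refine (Finset.abs_sum_le_sum_abs _ _).trans ?_
    refine (Finset.sum_le_sum (g := fun e => 2 * δ * design n e) fun e _ => ?_).trans ?_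
    · have e2 : (a e * above θ (winProb F μ e) + b e * above θ (1 - winProb F μ e)) / totalGames n
          - (a' e * above θ (winProb F μ e) + b' e * above θ (1 - winProb F μ e))
          = (a e / totalGames n - a' e) * above θ (winProb F μ e)
            + (b e / totalGames n - b' e) * above θ (1 - winProb F μ e) := by ring
      rw [e2]
      refine (abs_add_le _ _).trans ?_
      rw [abs_mul, abs_mul, abs_of_nonneg (above_nonneg _ _), abs_of_nonneg (above_nonneg _ _)]
      have h1 := mul_le_of_le_one_right (abs_nonneg (a e / totalGames n - a' e))
        (above_le_one θ (winProb F μ e))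
      have h2 := mul_le_of_le_one_right (abs_nonneg (b e / totalGames n - b' e))
        (above_le_one θ (1 - winProb F μ e))
      have := ha e
      have := hb e
      linarith
    · rw [← Finset.mul_sum]
      exact mul_le_of_le_one_right (by positivity) (sum_design_le_one n)
  have hw0 : ∀ e, n e = 0 → (w e : ℝ) = 0 := fun e he => by
    have := hwn e
    rw [he] at this
    simpa using this
  have hl0 : ∀ e, n e = 0 → (n e : ℝ) - w e = 0 := fun e he => by
    rw [hw0 e he, he]; simp
  rw [Prod.dist_eq, Real.dist_eq, Real.dist_eq]
  exact max_le (key _ _ _ _ hl0 hw0 hlD hwD) (key _ _ _ _ hw0 hl0 hwD hlD)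

/-- Strengths that order every played pair correctly give the stronger teams nearly the right
number of wins, in relative terms for the wins as well as the losses. -/
theorem abs_strongWins_sub_le {F : ℝ → ℝ} (hmono : Monotone F) (hhalf : F 0 = 1 / 2)
    {μ ν : Fin m → ℝ} {n w : Pair m → ℕ} (hwn : ∀ e, w e ≤ n e) {δ : ℝ} {e : Pair m}
    (hw : |(w e : ℝ) - n e * winProb F μ e| ≤
      δ * (n e * (winProb F μ e * (1 - winProb F μ e))))
    (hgt : n e ≠ 0 → 1 / 2 < winProb F μ e → 1 / 2 < winProb F ν e)
    (hlt : n e ≠ 0 → winProb F μ e < 1 / 2 → winProb F ν e < 1 / 2) :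
    |strongWins ν n w e - strongProb F μ e * n e| ≤
      δ * (n e * (strongProb F μ e * (1 - strongProb F μ e))) := by
  by_cases he : n e = 0
  · have := strongWins_mem_Icc ν hwn e
    rw [he] at this ⊢
    have : strongWins ν n w e = 0 := le_antisymm (by simpa using this.2) this.1
    simp [this]
  have hgt := hgt he
  have hlt := hlt he
  have pos : 1 / 2 < winProb F ν e → ν e.snd < ν e.fst := by
    intro h
    by_contra! h'
    have := hmono (sub_nonpos.2 h')
    unfold winProb at h
    linarith
  have neg : winProb F ν e < 1 / 2 → ν e.fst < ν e.snd := by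
    intro h
    by_contra! h'
    have := hmono (sub_nonneg.2 h')
    unfold winProb at h
    linarith
  unfold strongProb
  set p := winProb F μ e
  rcases lt_trichotomy p (1 / 2) with h | h | h
  · rw [max_eq_right (by linarith)]
    have h1 := neg (hlt h)
    rw [strongWins, if_neg h1.not_gt, if_pos h1,
      show ((n e : ℝ) - w e - (1 - p) * n e) = -(w e - n e * p) by ring, abs_neg]
    refine hw.trans (le_of_eq ?_)
    ring
  -- Here ν may order the pair either way or tie it: all three values of `strongWins` are within |w
  -- - n / 2| of n / 2.
  · rw [max_eq_left (by linarith)]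
    refine le_trans ?_ hw
    rw [h]
    unfold strongWins
    split_ifs
    · rw [mul_comm]
    · rw [show (n e : ℝ) - w e - 1 / 2 * n e = -(w e - n e * (1 / 2)) by ring, abs_neg]
    · rw [show (n e : ℝ) / 2 - 1 / 2 * n e = 0 by ring, abs_zero]
      exact abs_nonneg _
  · rw [max_eq_left (by linarith)]
    have h1 := pos (hgt h)
    rw [strongWins, if_pos h1, mul_comm p]
    exact hw

/-- As for the WL curves, only the weights differ off the jump set. Each coordinate is now a
quotient with its own random denominator, so the weights are compared through their relative errors,
using that q (1 - q) is at most q and at most 1 - q. -/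
theorem dist_dataSW_limitSW_le {F : ℝ → ℝ} (hF0 : ∀ x, 0 ≤ F x) (hF1 : ∀ x, F x ≤ 1)
    (hmono : Monotone F) (hhalf : F 0 = 1 / 2)
    {μ ν : Fin m → ℝ} {n w : Pair m → ℕ} (hwn : ∀ e, w e ≤ n e) {δ : ℝ} (hδ : 0 ≤ δ)
    (hδ1 : δ < 1)
    (hw : ∀ e, |(w e : ℝ) - n e * winProb F μ e| ≤
      δ * (n e * (winProb F μ e * (1 - winProb F μ e))))
    (hν : ∀ e, n e ≠ 0 → |winProb F ν e - winProb F μ e| ≤ δ)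
    (hgt : ∀ e, n e ≠ 0 → 1 / 2 < winProb F μ e → 1 / 2 < winProb F ν e)
    (hlt : ∀ e, n e ≠ 0 → winProb F μ e < 1 / 2 → winProb F ν e < 1 / 2)
    {θ : ℝ} (hθ : θ ∉ jumpSet F μ δ) :
    dist (dataSW F ν n w θ) (limitSW F μ (design n) θ) ≤ 2 * δ := by
  simp only [jumpSet, Set.mem_iUnion, Set.mem_union, not_exists, not_or] at hθ
  have hχ : ∀ e, n e ≠ 0 → above θ (strongProb F ν e) = above θ (strongProb F μ e) := by
    intro e he
    refine above_congr (abs_strongProb_sub_le (hν e he)) ?_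
    rcases max_choice (winProb F μ e) (1 - winProb F μ e) with h | h <;> rw [strongProb, h]
    exacts [(hθ e).1, (hθ e).2]
  have key : ∀ t r : Pair m → ℝ, (∀ e, 0 ≤ t e) → (∀ e, t e ≤ n e) → (∀ e, 0 ≤ r e) →
      (∀ e, |t e - r e * n e| ≤ δ * (r e * n e)) →
      |(∑ e, t e * above θ (strongProb F ν e)) / ∑ e, t e -
        (∑ e, r e * design n e * above θ (strongProb F μ e)) / ∑ e, r e * design n e|
          ≤ 2 * δ := by
    intro t r ht0 htn hr htr
    have e1 : ∀ e, t e * above θ (strongProb F ν e) = t e * above θ (strongProb F μ e) := by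
      intro e
      by_cases he : n e = 0
      · have := htn e
        rw [he] at this
        rw [le_antisymm (by simpa using this) (ht0 e)]; simp
      · rw [hχ e he]
    simp only [e1]
    refine le_trans (le_of_eq ?_) (abs_sum_mul_div_sum_sub_le hδ1 ht0
      (fun e => mul_nonneg (hr e) (Nat.cast_nonneg (n e))) htr
      (fun e => above_nonneg θ (strongProb F μ e)) (fun e => above_le_one θ (strongProb F μ e)) hδ)
    congr 2
    have e2 : ∀ e, r e * design n e = r e * n e / totalGames n := fun e => by
      unfold design; ring
    simp only [e2, div_mul_eq_mul_div, ← Finset.sum_div]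
    by_cases hN : totalGames n = 0
    · have hn : ∀ e, n e = 0 := fun e => by
        have := Finset.single_le_sum (f := n) (fun e _ => Nat.zero_le _) (Finset.mem_univ e)
        unfold totalGames at hN
        omega
      simp [hn]
    · exact div_div_div_cancel_right₀ (by exact_mod_cast hN) _ _
  have hq0 := strongProb_nonneg hF0 μ
  have hq1 := strongProb_le_one hF0 hF1 μ
  have hs := fun e => strongWins_mem_Icc ν hwn e
  have hb := fun e => abs_strongWins_sub_le hmono hhalf hwn (hw e) (hgt e) (hlt e)
  rw [Prod.dist_eq, Real.dist_eq, Real.dist_eq]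
  refine max_le (key _ (fun e => 1 - strongProb F μ e) (fun e => sub_nonneg.2 (hs e).2)
    (fun e => by linarith [(hs e).1]) (fun e => sub_nonneg.2 (hq1 e)) fun e => ?_)
    (key _ _ (fun e => (hs e).1) (fun e => (hs e).2) hq0 fun e => ?_)
  · rw [show (n e : ℝ) - strongWins ν n w e - (1 - strongProb F μ e) * n e
      = -(strongWins ν n w e - strongProb F μ e * n e) by ring, abs_neg]
    refine (hb e).trans (mul_le_mul_of_nonneg_left ?_ hδ)
    have : 0 ≤ (n e : ℝ) * (1 - strongProb F μ e) :=
      mul_nonneg (Nat.cast_nonneg _) (sub_nonneg.2 (hq1 e))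
    nlinarith [mul_le_mul_of_nonneg_left (hq1 e) this]
  · refine (hb e).trans (mul_le_mul_of_nonneg_left ?_ hδ)
    have : 0 ≤ (n e : ℝ) * strongProb F μ e := mul_nonneg (Nat.cast_nonneg _) (hq0 e)
    nlinarith [mul_nonneg this (hq0 e)]

/-! ### Median zero, the partition condition and Chebyshev's inequality -/

theorem wins_le (n : Pair m → ℕ) (y : Pair m → ℕ → Bool) (e : Pair m) : wins n y e ≤ n e := by
  refine (Finset.card_filter_le _ _).trans ?_
  rw [Finset.card_range]

/-- A continuous distribution that is symmetric about `0` has median `0`. -/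
theorem cdf_zero_of_symmetric (κ : Measure ℝ) [IsProbabilityMeasure κ]
    (hcont : Continuous (fun x => cdf κ x)) (hκ : κ.map (fun x => -x) = κ) :
    cdf κ 0 = 1 / 2 := by
  have h0 : κ {0} = 0 := by
    have hl : Function.leftLim (cdf κ) 0 = cdf κ 0 :=
      leftLim_eq_of_tendsto (hcont.tendsto 0 |>.mono_left nhdsWithin_le_nhds)
    rw [← measure_cdf κ, StieltjesFunction.measure_singleton, hl]
    simp
  have h1 : κ.real (Set.Iic 0) = κ.real (Set.Ici 0) := by
    have : κ (Set.Iic 0) = κ (Set.Ici 0) := by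
      conv_lhs => rw [← hκ]
      rw [Measure.map_apply measurable_neg measurableSet_Iic]
      simp
    simp [Measure.real, this]
  have h2 : κ.real (Set.Ici 0) = κ.real (Set.Ioi 0) := by
    have : κ.real {(0 : ℝ)} = 0 := by simp [Measure.real, h0]
    rw [← Set.Ioi_union_left,
      measureReal_union (by simp) (measurableSet_singleton _), this, add_zero]
  have h3 := probReal_compl_eq_one_sub (μ := κ) (measurableSet_Iic (a := (0 : ℝ)))
  rw [Set.compl_Iic] at h3
  rw [cdf_eq_real]
  linarith

/-- Data whose frequencies are close to the true probabilities, relative to the variances,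
satisfy the partition condition whenever some data of positive likelihood do. -/
theorem PartitionCondition.of_wins_close {n : Pair m → ℕ} {y₀ y : Pair m → ℕ → Bool}
    {p : Pair m → ℝ} {δ : ℝ} (hp0 : ∀ e, 0 ≤ p e) (hp1 : ∀ e, p e ≤ 1)
    (h0 : ∀ e k, p e = 0 → y₀ e k = false) (h1 : ∀ e k, p e = 1 → y₀ e k = true) (hδ : δ < 1)
    (hw : ∀ e, |(wins n y e : ℝ) - n e * p e| ≤ δ * (n e * (p e * (1 - p e))))
    (h : PartitionCondition n y₀) : PartitionCondition n y := by
  -- With δ < 1 the deviation is less than the mean n p, so at least one win occurs; `hloss` is the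
  -- same argument with n (1 - p).
  have hwin : ∀ e, p e ≠ 0 → n e ≠ 0 → ∃ k < n e, y e k = true := by
    intro e hp hn
    have hp : 0 < p e := (hp0 e).lt_of_ne' hp
    have hn : (0 : ℝ) < n e := by exact_mod_cast Nat.pos_of_ne_zero hn
    have h3 := (abs_le.1 (hw e)).1
    have h4 : δ * (n e * (p e * (1 - p e))) < n e * p e := by
      have h5 : 0 < n e * p e := by positivity
      have h6 : n e * (p e * (1 - p e)) ≤ n e * p e := by nlinarith
      have h7 : 0 ≤ n e * (p e * (1 - p e)) :=
        mul_nonneg hn.le (mul_nonneg hp.le (sub_nonneg.2 (hp1 e)))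
      rcases h7.eq_or_lt with h8 | h8
      · rw [← h8, mul_zero]; exact h5
      · nlinarith
    have h5 : (0 : ℝ) < wins n y e := by linarith
    have h6 : 0 < wins n y e := by exact_mod_cast h5
    obtain ⟨k, hk⟩ := Finset.card_pos.1 h6
    rw [Finset.mem_filter, Finset.mem_range] at hk
    exact ⟨k, hk⟩
  have hloss : ∀ e, p e ≠ 1 → n e ≠ 0 → ∃ k < n e, y e k = false := by
    intro e hp hn
    by_contra! hall
    have hp : 0 < 1 - p e := sub_pos.2 ((hp1 e).lt_of_ne hp)
    have hn : (0 : ℝ) < n e := by exact_mod_cast Nat.pos_of_ne_zero hn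
    have hwn : wins n y e = n e := by
      unfold wins
      rw [Finset.filter_true_of_mem, Finset.card_range]
      intro k hk
      simpa using hall k (Finset.mem_range.1 hk)
    have h3 := (abs_le.1 (hw e)).2
    rw [hwn] at h3
    have h5 : 0 < n e * (1 - p e) := by positivity
    have h6 : n e * (p e * (1 - p e)) ≤ n e * (1 - p e) := by nlinarith [hp1 e]
    have h7 : 0 ≤ n e * (p e * (1 - p e)) := mul_nonneg hn.le (mul_nonneg (hp0 e) hp.le)
    rcases h7.eq_or_lt with h8 | h8
    · rw [← h8] at h3; linarith
    · nlinarith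
  intro S hS hS'
  obtain ⟨b, hb, a, ha, hd⟩ := h S hS hS'
  refine ⟨b, hb, a, ha, hd.imp ?_ ?_⟩
  -- A win in `y₀` shows that p is not 0, hence `y` also contains a win of the same team over the
  -- same opponent.
  · rintro ⟨e, he1, he2, k, hk, hy⟩
    exact ⟨e, he1, he2, hwin e (fun hp => by simp [h0 e k hp] at hy) (by omega)⟩
  · rintro ⟨e, he1, he2, k, hk, hy⟩
    exact ⟨e, he1, he2, hloss e (fun hp => by simp [h1 e k hp] at hy) (by omega)⟩

section Probability
variable {Ω : Type*} [MeasurableSpace Ω] {P : Measure Ω} [IsProbabilityMeasure P]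

/-- Chebyshev's inequality for the number of successes in independent Bernoulli trials, also valid
for trials without randomness. -/
theorem measure_sq_card_sub_le {B : ℕ → Ω → Bool} (hB : ∀ k, Measurable (B k))
    (hind : Pairwise fun k l => IndepFun (B k) (B l) P) {p : ℝ} (hp : 0 ≤ p)
    (hlaw : ∀ k, P {ω | B k ω = true} = ENNReal.ofReal p) (n : ℕ) {C : ℝ} (hC : 0 < C) :
    P {ω | C * (n * (p * (1 - p))) <
      ((((Finset.range n).filter fun k => B k ω = true).card : ℝ) - n * p) ^ 2} ≤
        ENNReal.ofReal (1 / C) := by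
  let g : Bool → ℝ := fun b => if b = true then 1 else 0
  let X : ℕ → Ω → ℝ := fun k ω => g (B k ω)
  have hXm : ∀ k, Measurable (X k) := fun k => (measurable_of_finite g).comp (hB k)
  have hX2 : ∀ k, MemLp (X k) 2 P := fun k =>
    MemLp.of_bound (hXm k).aestronglyMeasurable 1 (.of_forall fun ω => by
      simp only [X, g]; split_ifs <;> simp)
  have hXi : ∀ k, P[X k] = p := by
    intro k
    have e : X k = Set.indicator {ω | B k ω = true} 1 := by
      ext ω; simp [X, g, Set.indicator_apply]
    have hm : MeasurableSet {ω | B k ω = true} := hB k (measurableSet_singleton true)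
    rw [e, integral_indicator_one hm, Measure.real, hlaw, ENNReal.toReal_ofReal hp]
  have hXv : ∀ k, Var[X k; P] = p * (1 - p) := by
    intro k
    have e : X k ^ 2 = X k := by
      ext ω; simp only [Pi.pow_apply, X, g]; split_ifs <;> simp
    rw [variance_eq_sub (hX2 k), e, hXi]; ring
  set S : Ω → ℝ := ∑ k ∈ Finset.range n, X k with hS
  have hScard : ∀ ω, S ω = (((Finset.range n).filter fun k => B k ω = true).card : ℝ) := by
    intro ω
    simp [hS, X, g, Finset.sum_apply, Finset.sum_boole]
  have hS2 : MemLp S 2 P := memLp_finsetSum' _ fun k _ => hX2 k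
  have hSi : P[S] = n * p := by
    have : P[S] = ∑ k ∈ Finset.range n, P[X k] := by
      rw [← integral_finsetSum _ fun k _ => (hX2 k).integrable (by norm_num)]
      simp [hS]
    rw [this]; simp [hXi]
  have hSv : Var[S; P] = n * (p * (1 - p)) := by
    rw [hS, IndepFun.variance_sum (fun k _ => hX2 k) fun k _ l _ hkl =>
      (hind hkl).comp (measurable_of_finite g) (measurable_of_finite g)]
    simp [hXv]
  simp only [← hScard]
  rw [← hSi]
  rw [← hSv]
  -- Chebyshev needs a positive radius. With variance 0 the sum is almost surely its mean, and the
  -- strict inequality defining the event fails.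
  rcases (variance_nonneg S P).eq_or_lt with h | h
  · have hev : evariance S P = 0 := by
      rw [← hS2.ofReal_variance_eq, ← h, ENNReal.ofReal_zero]
    have hae := (evariance_eq_zero_iff hS2.aemeasurable).1 hev
    refine le_of_eq_of_le (measure_eq_zero_iff_ae_notMem.2 ?_) zero_le
    filter_upwards [hae] with ω hω
    simp [hω, ← h]
  · have hc : 0 < √(C * Var[S; P]) := Real.sqrt_pos.2 (by positivity)
    refine (measure_mono fun ω hω => ?_).trans
      ((meas_ge_le_variance_div_sq hS2 hc).trans (le_of_eq ?_))
    · exact Real.sqrt_le_iff.2 ⟨abs_nonneg _, by rw [sq_abs]; exact le_of_lt hω⟩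
    · rw [Real.sq_sqrt (by positivity)]
      congr 1
      field_simp

end Probability

/-! ### The good event and the conclusion -/

/-- On data whose frequencies are within `√C` standard deviations of the true probabilities, and
for large counts, the estimated and the true curves are close to the limiting ones. -/
theorem dist_data_limit_le {F : ℝ → ℝ} (hF0 : ∀ x, 0 ≤ F x) (hF1 : ∀ x, F x ≤ 1)
    (hmono : Monotone F) (hhalf : F 0 = 1 / 2) {c : Fin m → ℝ} {b : ℝ} {μ : Fin m → ℝ}
    (hμ : μ ∈ constraintRegion c b) {C δ : ℝ} (hC : 0 ≤ C) (hδ : 0 < δ) (hδ1 : δ < 1) :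
    ∃ N : ℕ, ∀ (n : Pair m → ℕ) (y₀ y : Pair m → ℕ → Bool) (ν : Fin m → ℝ),
      (∀ e, n e ≠ 0 → N < n e) →
      (∀ e k, winProb F μ e = 0 → y₀ e k = false) → (∀ e k, winProb F μ e = 1 → y₀ e k = true) →
      PartitionCondition n y₀ →
      (∀ e, ((wins n y e : ℝ) - n e * winProb F μ e) ^ 2 ≤
        C * (n e * (winProb F μ e * (1 - winProb F μ e)))) →
      (PartitionCondition n y → IsMLE F c b n (wins n y) ν) →
      ∀ θ ∉ jumpSet F μ δ,
        dist (dataWL F ν n (wins n y) θ) (limitWL F μ (design n) θ) ≤ 2 * δ ∧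
        dist (dataWL F μ n (wins n y) θ) (limitWL F μ (design n) θ) ≤ 2 * δ ∧
        dist (dataSW F ν n (wins n y) θ) (limitSW F μ (design n) θ) ≤ 2 * δ ∧
        dist (dataSW F μ n (wins n y) θ) (limitSW F μ (design n) θ) ≤ 2 * δ := by
  have hp0 : ∀ e, 0 ≤ winProb F μ e := fun e => hF0 _
  have hp1 : ∀ e, winProb F μ e ≤ 1 := fun e => hF1 _
  choose N hN using fun e : Pair m =>
    exists_count_bound (C := C) (K := 2 * (Fintype.card (Pair m) * C)) (hp0 e) (hp1 e) hδ
  refine ⟨Finset.univ.sup N, fun n y₀ y ν hn h0 h1 hpart hgood hmle θ hθ => ?_⟩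
  have hn' : ∀ e, n e ≠ 0 → N e < n e := fun e he =>
    (Finset.le_sup (Finset.mem_univ e)).trans_lt (hn e he)
  have hwn := wins_le n y
  have hw : ∀ e, |(wins n y e : ℝ) - n e * winProb F μ e| ≤
      δ * (n e * (winProb F μ e * (1 - winProb F μ e))) := by
    intro e
    by_cases he : n e = 0
    · have : wins n y e = 0 := by have := hwn e; omega
      simp [he, this]
    · exact (hN e _ (hn' e he) _ (hgood e)).1
  have hν := hmle (hpart.of_wins_close hp0 hp1 h0 h1 hδ1 hw)
  have hfit := sq_sub_le_of_likelihood_le hF0 hF1 hwn hC hgood (hν.2 hμ)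
  have hx := fun e he => (hN e _ (hn' e he) _ (hgood e)).2 _ (hfit e)
  -- The true curves are the case ν = μ of the same estimates.
  have hδ0 : ∀ e, n e ≠ 0 → |winProb F μ e - winProb F μ e| ≤ δ := fun e _ => by
    simpa using hδ.le
  exact ⟨dist_dataWL_limitWL_le hF0 hF1 hwn hδ.le hw (fun e he => (hx e he).1) hθ,
    dist_dataWL_limitWL_le hF0 hF1 hwn hδ.le hw hδ0 hθ,
    dist_dataSW_limitSW_le hF0 hF1 hmono hhalf hwn hδ.le hδ1 hw (fun e he => (hx e he).1)
      (fun e he => (hx e he).2.1) (fun e he => (hx e he).2.2) hθ,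
    dist_dataSW_limitSW_le hF0 hF1 hmono hhalf hwn hδ.le hδ1 hw hδ0
      (fun e _ h => h) (fun e _ h => h) hθ⟩

end PairedComparison

open PairedComparison in
theorem theorem1 {m : ℕ}
    -- the link function is the CDF of a symmetric continuous distribution `κ`
    (κ : MeasureTheory.Measure ℝ) [MeasureTheory.IsProbabilityMeasure κ]
    (hcont : Continuous (fun x => ProbabilityTheory.cdf κ x)) (hκ : κ.map (fun x => -x) = κ)
    -- the linear constraint and the true strengths
    (c : Fin m → ℝ) (b : ℝ) (hc : ∑ i, c i ≠ 0)
    (μ : Fin m → ℝ) (hμ : μ ∈ PairedComparison.constraintRegion c b)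
    -- the independent game outcomes
    {Ω : Type*} [MeasurableSpace Ω] (P : MeasureTheory.Measure Ω)
    [MeasureTheory.IsProbabilityMeasure P]
    (Y : PairedComparison.Pair m → ℕ → Ω → Bool)
    (hYmeas : ∀ e k, Measurable (Y e k))
    (hYindep : ProbabilityTheory.iIndepFun
      (fun (x : PairedComparison.Pair m × ℕ) (ω : Ω) => Y x.1 x.2 ω) P)
    (hYlaw : ∀ e k, P {ω | Y e k ω = true} =
      ENNReal.ofReal (PairedComparison.winProb (ProbabilityTheory.cdf κ) μ e))
    -- for all pair counts `n`, a maximum likelihood estimate wherever the data satisfy the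
    -- partition condition, and an arbitrary vector elsewhere
    (muHat : (PairedComparison.Pair m → ℕ) → Ω → Fin m → ℝ)
    (hmuHat : ∀ n ω, PairedComparison.PartitionCondition n (fun e k => Y e k ω) →
      PairedComparison.IsMLE (ProbabilityTheory.cdf κ) c b n
        (PairedComparison.wins n (fun e k => Y e k ω)) (muHat n ω))
    -- the ROC metric
    (ρ : ℝ × ℝ → ℝ × ℝ → ℝ) (hρ : PairedComparison.IsPlaneMetric ρ) (z : ℝ) (hz : 1 ≤ z)
    (ε : ℝ) (hε : 0 < ε) :
    ∃ Nstar : ℕ, ∀ n : PairedComparison.Pair m → ℕ,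
      (∀ e, n e ≠ 0 → Nstar < n e) →
      0 < P {ω | PairedComparison.PartitionCondition n (fun e k => Y e k ω)} →
      (P {ω | ε ≤ PairedComparison.rocDist ρ z
            (PairedComparison.dataWL (ProbabilityTheory.cdf κ) (muHat n ω) n
              (PairedComparison.wins n (fun e k => Y e k ω)))
            (PairedComparison.dataWL (ProbabilityTheory.cdf κ) μ n
              (PairedComparison.wins n (fun e k => Y e k ω)))} < ENNReal.ofReal ε ∧
        P {ω | ε ≤ PairedComparison.rocDist ρ z
            (PairedComparison.dataSW (ProbabilityTheory.cdf κ) (muHat n ω) n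
              (PairedComparison.wins n (fun e k => Y e k ω)))
            (PairedComparison.dataSW (ProbabilityTheory.cdf κ) μ n
              (PairedComparison.wins n (fun e k => Y e k ω)))} < ENNReal.ofReal ε) ∧
      ∀ D : PairedComparison.Pair m → ℝ,
        (∀ e, D e = (n e : ℝ) / (PairedComparison.totalGames n : ℝ)) →
        P {ω | ε ≤ PairedComparison.rocDist ρ z
            (PairedComparison.dataWL (ProbabilityTheory.cdf κ) (muHat n ω) n
              (PairedComparison.wins n (fun e k => Y e k ω)))
            (PairedComparison.limitWL (ProbabilityTheory.cdf κ) μ D)} < ENNReal.ofReal ε ∧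
        P {ω | ε ≤ PairedComparison.rocDist ρ z
            (PairedComparison.dataSW (ProbabilityTheory.cdf κ) (muHat n ω) n
              (PairedComparison.wins n (fun e k => Y e k ω)))
            (PairedComparison.limitSW (ProbabilityTheory.cdf κ) μ D)} < ENNReal.ofReal ε := by
  have hF0 : ∀ x, 0 ≤ cdf κ x := cdf_nonneg κ
  have hF1 : ∀ x, cdf κ x ≤ 1 := cdf_le_one κ
  have hhalf := cdf_zero_of_symmetric κ hcont hκ
  obtain ⟨η, hη, hroc⟩ := exists_rocDist_lt hρ hz hε
  set K : ℝ := ((Fintype.card (Pair m) : ℕ) : ℝ) with hK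
  have hK0 : 0 ≤ K := Nat.cast_nonneg _
  -- The choice gives both 4 K δ ≤ η, for the length of the jump set, and 4 δ ≤ η, for two distances
  -- of 2 δ through the limiting curve.
  set δ : ℝ := min (1 / 2) (η / (4 * (K + 1))) with hδdef
  have hδ : 0 < δ := by positivity
  have hδ1 : δ < 1 := (min_le_left _ _).trans_lt (by norm_num)
  have hδη : (K + 1) * (4 * δ) ≤ η := by
    have := min_le_right (1 / 2) (η / (4 * (K + 1)))
    rw [← hδdef, le_div_iff₀ (by positivity)] at this
    linarith
  have hKδ := mul_nonneg hK0 hδ.le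
  -- Chosen so that the union bound K / C is less than ε.
  set C : ℝ := K / ε + 1 with hCdef
  have hC : 0 < C := by positivity
  obtain ⟨N, hN⟩ := dist_data_limit_le hF0 hF1 (monotone_cdf κ) hhalf hμ hC.le hδ hδ1
  refine ⟨N, fun n hn hpart => ?_⟩
  set p := winProb (cdf κ) μ
  have hp0 : ∀ e, 0 ≤ p e := fun e => hF0 _
  let y : Ω → Pair m → ℕ → Bool := fun ω e k => Y e k ω
  let bad : Set Ω := ⋃ e, {ω | C * (n e * (p e * (1 - p e))) <
    ((wins n (y ω) e : ℝ) - n e * p e) ^ 2}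
  have hbad : P bad < ENNReal.ofReal ε := by
    refine ((measure_iUnion_fintype_le _ _).trans (Finset.sum_le_card_nsmul _ _
      (ENNReal.ofReal (1 / C)) fun e _ => measure_sq_card_sub_le (hYmeas e)
        (fun k l hkl => hYindep.indepFun (i := (e, k)) (j := (e, l)) (by simpa using hkl))
        (hp0 e) (hYlaw e) (n e) hC)).trans_lt ?_
    rw [nsmul_eq_mul, ← ENNReal.ofReal_natCast, ← ENNReal.ofReal_mul (Nat.cast_nonneg _),
      ENNReal.ofReal_lt_ofReal_iff hε, Finset.card_univ, ← hK, mul_one_div, div_lt_iff₀ hC, hCdef]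
    field_simp
    linarith
  obtain ⟨y₀, h0, h1, hy₀⟩ : ∃ y₀ : Pair m → ℕ → Bool, (∀ e k, p e = 0 → y₀ e k = false) ∧
      (∀ e k, p e = 1 → y₀ e k = true) ∧ PartitionCondition n y₀ := by
    have hae : ∀ᵐ ω ∂P, ∀ e k, (p e = 0 → Y e k ω = false) ∧ (p e = 1 → Y e k ω = true) := by
      refine ae_all_iff.2 fun e => ae_all_iff.2 fun k => ?_
      have hlaw := hYlaw e k
      by_cases hz0 : p e = 0
      · rw [hz0, ENNReal.ofReal_zero] at hlaw
        filter_upwards [measure_eq_zero_iff_ae_notMem.1 hlaw] with ω hω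
        exact ⟨fun _ => by simpa using hω, fun h => by rw [hz0] at h; norm_num at h⟩
      by_cases hz1 : p e = 1
      · rw [hz1, ENNReal.ofReal_one] at hlaw
        have hm : MeasurableSet {ω | Y e k ω = true} :=
          hYmeas e k (measurableSet_singleton true)
        filter_upwards [(mem_ae_iff_prob_eq_one hm).2 hlaw] with ω hω
        exact ⟨fun h => absurd h hz0, fun _ => hω⟩
      · exact .of_forall fun ω => ⟨fun h => absurd h hz0, fun h => absurd h hz1⟩
    -- An event of positive probability meets the almost sure event on which the games with p = 0 or
    -- p = 1 have their certain outcome.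
    obtain ⟨ω, hω, hω'⟩ := (frequently_ae_mem_iff.2 hpart.ne').and_eventually hae |>.exists
    exact ⟨y ω, fun e k => (hω' e k).1, fun e k => (hω' e k).2, hω⟩
  have hclose : ∀ ω ∉ bad, _ := fun ω hω => hN n y₀ (y ω) (muHat n ω) hn h0 h1 hy₀
    (fun e => not_lt.1 fun h => hω (Set.mem_iUnion.2 ⟨e, h⟩)) (hmuHat n ω)
  have hvol : volume (jumpSet (cdf κ) μ δ) ≤ ENNReal.ofReal η :=
    (volume_jumpSet_le _ _ hδ.le).trans (ENNReal.ofReal_le_ofReal (by linarith))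
  have hmeas := measurableSet_jumpSet (cdf κ) μ δ
  have hwn := fun ω => wins_le n (y ω)
  have finish : ∀ f g : Ω → ROCCurve, (∀ ω θ, f ω θ ∈ Set.Icc 0 1) →
      (∀ ω θ, g ω θ ∈ Set.Icc 0 1) →
      (∀ ω ∉ bad, ∀ θ ∉ jumpSet (cdf κ) μ δ, dist (f ω θ) (g ω θ) ≤ 4 * δ) →
      P {ω | ε ≤ rocDist ρ z (f ω) (g ω)} < ENNReal.ofReal ε := by
    intro f g hf hg hfg
    -- Monotonicity holds for arbitrary sets, so the estimator need not be measurable.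
    refine (measure_mono fun ω hω => ?_).trans_lt hbad
    by_contra hω'
    exact not_lt.2 hω (hroc _ _ _ (hf ω) (hg ω) hmeas hvol fun θ hθ =>
      (hfg ω hω' θ hθ).trans (by linarith))
  refine ⟨⟨?_, ?_⟩, fun D hD => ?_⟩
  · refine finish _ _ (fun ω => dataWL_mem_Icc _ _ (hwn ω)) (fun ω => dataWL_mem_Icc _ _ (hwn ω))
      fun ω hω θ hθ => ?_
    obtain ⟨h1, h2, -, -⟩ := hclose ω hω θ hθ
    exact (dist_triangle_right _ _ _).trans ((add_le_add h1 h2).trans (by linarith))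
  · refine finish _ _ (fun ω => dataSW_mem_Icc _ _ (hwn ω)) (fun ω => dataSW_mem_Icc _ _ (hwn ω))
      fun ω hω θ hθ => ?_
    obtain ⟨-, -, h1, h2⟩ := hclose ω hω θ hθ
    exact (dist_triangle_right _ _ _).trans ((add_le_add h1 h2).trans (by linarith))
  · obtain rfl : D = design n := funext hD
    exact ⟨finish _ _ (fun ω => dataWL_mem_Icc _ _ (hwn ω))
        (fun _ => limitWL_mem_Icc hF0 hF1 μ n)
        fun ω hω θ hθ => (hclose ω hω θ hθ).1.trans (by linarith),
      finish _ _ (fun ω => dataSW_mem_Icc _ _ (hwn ω)) (fun _ => limitSW_mem_Icc hF0 hF1 μ n)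
        fun ω hω θ hθ => (hclose ω hω θ hθ).2.2.1.trans (by linarith)⟩
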